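/- Let $L^2(\mathbb{R}_+)=L^2((0,\infty);\mathbb{C})$, let $\mathbb{C}_+=\{s\in\mathbb{C}:\operatorname{Re}s>0\}$, and let $\mathcal{L}(\phi)(s)=\int_0^\infty e^{-st}\phi(t)\,dt$ for $s\in\mathbb{C}_+$. Let $H^2(\mathbb{C}_+)$ be the Hardy space of analytic functions $\Phi$ on $\mathbb{C}_+$ with $\sup_{x>0}\frac1{2\pi}\int_{-\infty}^\infty|\Phi(x+iy)|^2\,dy<\infty$; by the Paley–Wiener theorem $\mathcal{L}:L^2(\mathbb{R}_+)\to H^2(\mathbb{C}_+)$ is bijective, with inverse $\mathcal{L}^{-1}$. Let $\partial_t$ be the (weak) derivative on $L^2(\mathbb{R}_+)$, with domain the functions in $L^2(\mathbb{R}_+)$ whose weak derivative is in $L^2(\mathbb{R}_+)$. A vector $v$ is called $f$-analytic for $\partial_t$ if it lies in the domain of $\partial_t^n$ for all $n\ge 0$ and $\sum_{n\ge0}\frac{f^{(n)}(0)}{n!}\partial_t^nv$ converges in $L^2(\mathbb{R}_+)$ (that is, its partial sums converge). Let $D_f$ be the set of pairs $(\phi,r)$, with $\phi\in L^2(\mathbb{R}_+)$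 and $r$ a function analytic on a region of $\mathbb{C}$, such that $f\mathcal{L}(\phi)-r\in H^2(\mathbb{C}_+)$, and for $(\phi,r)\in D_f$ put $f(\partial_t)(\phi,r)=\mathcal{L}^{-1}(f\mathcal{L}(\phi)-r)\in L^2(\mathbb{R}_+)$. Let $f$ be an entire function and let $\phi\in L^2(\mathbb{R}_+)$ be a function that is $C^\infty$ on $[0,\infty)$ and is an $f$-analytic vector for $\partial_t$. Suppose that there are constants $C$ and $0<R<1$ with $|\phi^{(j)}(0)|\le CR^j$ for all $j\ge0$. Then the series $$r(s)=\sum_{n=1}^\infty\sum_{j=1}^n\frac{f^{(n)}(0)}{n!}\,\phi^{(j-1)}(0)\,s^{n-j}$$ (summed over $n$) converges for every $s\in\mathbb{C}$ and defines an entire function, and $(\phi,r)\in D_f$. Moreover, $\mathcal{L}(f(\partial_t)(\phi,r))=f\mathcal{L}(\phi)-r$ on $\mathbb{C}_+$, all the derivatives $\partial_t^n\phi=\phi^{(n)}$ are in $L^2(\mathbb{R}_+)$, and $$f(\partial_t)(\phi,r)=\sum_{n=0}^\infty\frac{f^{(n)}(0)}{n!}\,\partial_t^n\phi\qquad\text{in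 }L^2(\mathbb{R}_+).$$ -/

import Mathlib

open MeasureTheory Set Filter Topology

noncomputable section

namespace InfiniteOrder

/-! ### The space `L²(ℝ₊)` and the operator `∂_t` on it -/

/-- Lebesgue measure on the half-line `(0, ∞)`. -/
abbrev halfLine : Measure ℝ := volume.restrict (Ioi (0 : ℝ))

/-- The complex Hilbert space `L²(ℝ₊)`. -/
abbrev L2 : Type := Lp ℂ 2 halfLine

/-- `v` is the weak (distributional) derivative of `u` on `(0, ∞)`. -/
def IsWeakDeriv (u v : ℝ → ℂ) : Prop :=
  ∀ ψ : ℝ → ℝ, ContDiff ℝ (⊤ : ℕ∞) ψ → HasCompactSupport ψ → tsupport ψ ⊆ Ioi 0 →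
    ∫ t in Ioi (0 : ℝ), deriv ψ t • u t = -∫ t in Ioi (0 : ℝ), ψ t • v t

theorem integrable_smul_of_test (u : L2) {ψ : ℝ → ℝ} (hc : Continuous ψ)
    (hs : HasCompactSupport ψ) : Integrable (fun t => ψ t • u t) halfLine := by
  have h1 : MemLp ψ 2 halfLine := (hc.memLp_of_hasCompactSupport (μ := volume) hs).restrict _
  have h2 : MemLp (u : ℝ → ℂ) 2 halfLine := Lp.memLp u
  exact memLp_one_iff_integrable.1 (h2.smul h1)

/-- The graph of `∂_t`: pairs `(u, v)` in `L²(ℝ₊)` with `u' = v` weakly. -/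
def derivGraph : Submodule ℂ (L2 × L2) where
  carrier := {p | IsWeakDeriv p.1 p.2}
  zero_mem' := by
    intro ψ _ _ _
    have h : ((0 : L2) : ℝ → ℂ) =ᵐ[halfLine] 0 := Lp.coeFn_zero ℂ 2 halfLine
    have e : ∀ χ : ℝ → ℝ, ∫ t in Ioi (0 : ℝ), χ t • (0 : L2) t = 0 := by
      intro χ
      rw [← integral_zero ℝ ℂ (μ := halfLine)]
      refine integral_congr_ae ?_
      filter_upwards [h] with t ht
      rw [ht, Pi.zero_apply, smul_zero]
    simp only [Prod.fst_zero, Prod.snd_zero]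
    rw [e, e, neg_zero]
  add_mem' := by
    rintro ⟨u, v⟩ ⟨u', v'⟩ h h' ψ h1 h2 h3
    have hψ : Continuous ψ := h1.continuous
    have hψ' : Continuous (deriv ψ) := h1.continuous_deriv (by norm_num)
    have e : ∀ (χ : ℝ → ℝ) (_ : Continuous χ) (_ : HasCompactSupport χ) (a b : L2),
        ∫ t in Ioi (0 : ℝ), χ t • (a + b : L2) t
          = (∫ t in Ioi (0 : ℝ), χ t • a t) + ∫ t in Ioi (0 : ℝ), χ t • b t := by
      intro χ k1 k2 a b
      rw [← integral_add (integrable_smul_of_test a k1 k2) (integrable_smul_of_test b k1 k2)]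
      refine integral_congr_ae ?_
      filter_upwards [Lp.coeFn_add a b] with t ht
      rw [ht, Pi.add_apply, smul_add]
    have k := h ψ h1 h2 h3
    have k' := h' ψ h1 h2 h3
    simp only [Prod.mk_add_mk] at k k' ⊢
    rw [e _ hψ' h2.deriv, e _ hψ h2, k, k', neg_add]
  smul_mem' := by
    rintro c ⟨u, v⟩ h ψ h1 h2 h3
    have e : ∀ (χ : ℝ → ℝ) (a : L2),
        ∫ t in Ioi (0 : ℝ), χ t • (c • a : L2) t = c * ∫ t in Ioi (0 : ℝ), χ t • a t := by
      intro χ a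
      rw [← integral_const_mul]
      refine integral_congr_ae ?_
      filter_upwards [Lp.coeFn_smul c a] with t ht
      rw [ht, Pi.smul_apply, smul_eq_mul, mul_smul_comm]
    have k := h ψ h1 h2 h3
    simp only [Prod.smul_mk] at k ⊢
    rw [e, e, k, mul_neg]

/-- Weak derivatives are unique, so `derivGraph` is the graph of an operator. -/
theorem derivGraph_single_valued (p : L2 × L2) (hp : p ∈ derivGraph) (h0 : p.1 = 0) :
    p.2 = 0 := by
  obtain ⟨u, v⟩ := p
  simp only at h0
  subst h0
  have hv : LocallyIntegrableOn (v : ℝ → ℂ) (Ioi 0) volume := by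
    rw [locallyIntegrableOn_iff isOpen_Ioi.isLocallyClosed]
    · intro k hk hkc
      have h1 : MemLp (v : ℝ → ℂ) 2 (volume.restrict k) :=
        (Lp.memLp v).mono_measure (Measure.restrict_mono hk le_rfl)
      have : IsFiniteMeasure (volume.restrict k) := ⟨by simpa using hkc.measure_lt_top⟩
      exact h1.integrable (by norm_num)
  have key := isOpen_Ioi.ae_eq_zero_of_integral_contDiff_smul_eq_zero hv (fun g g1 g2 g3 => by
    have h := hp g g1 g2 g3
    have z : ((0 : L2) : ℝ → ℂ) =ᵐ[halfLine] 0 := Lp.coeFn_zero ℂ 2 halfLine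
    have z' : ∫ t in Ioi (0 : ℝ), deriv g t • (0 : L2) t = 0 := by
      rw [← integral_zero ℝ ℂ (μ := halfLine)]
      refine integral_congr_ae ?_
      filter_upwards [z] with t ht
      rw [ht, Pi.zero_apply, smul_zero]
    simp only at h
    rw [z', eq_comm, neg_eq_zero] at h
    rw [← h, setIntegral_eq_integral_of_forall_compl_eq_zero]
    intro t ht
    rw [image_eq_zero_of_notMem_tsupport (fun hh => ht (g3 hh)), zero_smul])
  refine Lp.ext ?_
  have z : ((0 : L2) : ℝ → ℂ) =ᵐ[halfLine] 0 := Lp.coeFn_zero ℂ 2 halfLine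
  filter_upwards [z, (ae_restrict_iff' measurableSet_Ioi).2 key] with t h1 h2
  rw [h1, h2, Pi.zero_apply]

/-- The operator `∂_t` on `L²(ℝ₊)`, with its maximal domain: the functions in `L²(ℝ₊)` whose weak
derivative is again in `L²(ℝ₊)`. -/
def ddt : L2 →ₗ.[ℂ] L2 := derivGraph.toLinearPMap

theorem ddt_graph : ddt.graph = derivGraph :=
  derivGraph.toLinearPMap_graph_eq derivGraph_single_valued

/-! ### `f`-analytic vectors of an operator -/

/-- `v` lies in the domain of `Aⁿ` for every `n`, and `w n = Aⁿ v`. -/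
def IsOrbit {V : Type*} [NormedAddCommGroup V] [NormedSpace ℂ V] (A : V →ₗ.[ℂ] V)
    (v : V) (w : ℕ → V) : Prop :=
  w 0 = v ∧ ∀ n, (w n, w (n + 1)) ∈ A.graph

/-- The Taylor coefficient `f⁽ⁿ⁾(0) / n!`. -/
def taylorCoeff (f : ℂ → ℂ) (n : ℕ) : ℂ := iteratedDeriv n f 0 / (n.factorial : ℂ)

/-- `v` is an `f`-analytic vector of `A`: it lies in the domain of every power of `A`, and the
series `∑ f⁽ⁿ⁾(0)/n! Aⁿ v` converges (that is, its partial sums do) in `V`. -/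
def IsAnalyticVector {V : Type*} [NormedAddCommGroup V] [NormedSpace ℂ V] (f : ℂ → ℂ)
    (A : V →ₗ.[ℂ] V) (v : V) : Prop :=
  ∃ w : ℕ → V, IsOrbit A v w ∧
    ∃ L : V, Tendsto (fun N => ∑ n ∈ Finset.range N, taylorCoeff f n • w n) atTop (𝓝 L)

/-! ### Laplace transform, Hardy space and the operator `f(∂_t)` -/

/-- The Laplace transform `∫₀^∞ e^{-st} φ(t) dt`. -/
def laplace (φ : ℝ → ℂ) (s : ℂ) : ℂ := ∫ t in Ioi (0 : ℝ), Complex.exp (-s * t) * φ t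

/-- The open right half-plane. -/
def rightHalfPlane : Set ℂ := {s | 0 < s.re}

/-- The mean `μ_q(Φ, x) = ((1/2π) ∫ |Φ(x+iy)|^q dy)^{1/q}`. -/
def hardyMean (q : ℝ) (Φ : ℂ → ℂ) (x : ℝ) : ENNReal :=
  ((ENNReal.ofReal (2 * Real.pi))⁻¹ * ∫⁻ y : ℝ, ‖Φ (x + y * Complex.I)‖ₑ ^ q) ^ (1 / q)

/-- `Φ` belongs to the Hardy space `H^q(ℂ₊)`; only the values of `Φ` on `ℂ₊` matter. -/
def IsHardy (q : ℝ) (Φ : ℂ → ℂ) : Prop :=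
  DifferentiableOn ℂ Φ rightHalfPlane ∧
    ∃ M : NNReal, ∀ x : ℝ, 0 < x → hardyMean q Φ x ≤ M

open Classical in
/-- The inverse Laplace transform: the element of `L²(ℝ₊)` whose Laplace transform is `G` on `ℂ₊`.
By the Paley-Wiener theorem it exists and is unique for every `G` in `H²(ℂ₊)`; functions that are
not Laplace transforms are sent to the junk value `0`. -/
def inverseLaplace (G : ℂ → ℂ) : L2 :=
  if h : ∃ u : L2, EqOn (laplace u) G rightHalfPlane then h.choose else 0

/-- The functions that are analytic on some region (non-empty connected open set) of `ℂ`. -/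
def analyticFunctions : Set (ℂ → ℂ) :=
  {r | ∃ Ω : Set ℂ, IsOpen Ω ∧ IsConnected Ω ∧ DifferentiableOn ℂ r Ω}

/-- The function `f 𝓛(φ) - r`. -/
def hat (f : ℂ → ℂ) (φ : L2) (r : ℂ → ℂ) (s : ℂ) : ℂ := f s * laplace φ s - r s

/-- The domain `D_f` of `f(∂_t)`: the pairs `(φ, r)` for which `f 𝓛(φ) - r` is in `H²(ℂ₊)`. -/
def symbolDomain (f : ℂ → ℂ) : Set (L2 × (ℂ → ℂ)) :=
  {p | p.2 ∈ analyticFunctions ∧ IsHardy 2 (hat f p.1 p.2)}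

/-- The operator `f(∂_t) : D_f → L²(ℝ₊)`, `f(∂_t)(φ, r) = 𝓛⁻¹(f 𝓛(φ) - r)`. -/
def symbolOp (f : ℂ → ℂ) (p : symbolDomain f) : L2 := inverseLaplace (hat f p.1.1 p.1.2)

/-- The `n`-th term `∑_{j=1}^n f⁽ⁿ⁾(0)/n! d_{j-1} s^{n-j}` of the initial-data series. -/
def initialTerm (f : ℂ → ℂ) (d : ℕ → ℂ) (s : ℂ) (n : ℕ) : ℂ :=
  ∑ j ∈ Finset.Icc 1 n, taylorCoeff f n * d (j - 1) * s ^ (n - j)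

/-- The series `r(s) = ∑_{n ≥ 1} ∑_{j=1}^n f⁽ⁿ⁾(0)/n! d_{j-1} s^{n-j}`
(the term `n = 0` is an empty sum). -/
def initialSeries (f : ℂ → ℂ) (d : ℕ → ℂ) (s : ℂ) : ℂ := ∑' n : ℕ, initialTerm f d s n

/-- The derivative `φ⁽ⁿ⁾` of a function on `[0, ∞)`, one-sided at `0`. -/
def derivHalf (n : ℕ) (φ : ℝ → ℂ) : ℝ → ℂ := iteratedDerivWithin n φ (Ici 0)

end InfiniteOrder

end

/-! For fixed s with Re s > 0, the map u ↦ 𝓛(u)(s) is an inner product with an L² kernel, hence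
continuous on L²(ℝ₊). It can be applied to the partial sums of ∑ f⁽ⁿ⁾(0)/n! φ⁽ⁿ⁾, which converge to
some L because φ is f-analytic. Integration by parts (`laplace_derivHalf`) turns 𝓛(φ⁽ⁿ⁾)(s) into sⁿ
𝓛(φ)(s) minus a polynomial in s built from the initial data. The first parts sum to f(s) 𝓛(φ)(s) and
the second to r(s), so 𝓛(L) = f 𝓛(φ) - r on ℂ₊ (`laplace_of_tendsto`). Both series converge because
the Taylor coefficients of an entire function are summable against every geometric sequence.

Plancherel on vertical lines then shows that 𝓛 maps L² into H² (`isHardy_laplace`), which puts (φ,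
r) in D_f, and that 𝓛 is injective (`laplace_injective`), which identifies f(∂_t)(φ, r) with L.
Surjectivity of 𝓛 onto H² is never needed, since the preimage L is already at hand. Uniqueness of
weak derivatives identifies the abstract orbit of φ with its classical derivatives. -/

noncomputable section

namespace InfiniteOrder

/-! ### Plancherel on L¹ ∩ L² -/

open FourierTransform SchwartzMap in
/-- The `L²` Fourier transform agrees with the Fourier integral on `L¹ ∩ L²`. -/
theorem fourier_toLp_ae_eq {g : ℝ → ℂ} (h1 : Integrable g) (h2 : MemLp g 2) :
    (𝓕 (h2.toLp g) : Lp ℂ 2 (volume : Measure ℝ)) =ᵐ[volume] 𝓕 g := by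
  have hint : LocallyIntegrable (𝓕 g) :=
    (VectorFourier.fourierIntegral_continuous Real.continuous_fourierChar
      continuous_inner h1).locallyIntegrable
  refine ae_eq_of_integral_contDiff_smul_eq
    ((Lp.memLp _).locallyIntegrable (by norm_num)) hint fun ψ hψ hψc => ?_
  have c1 : HasCompactSupport (Complex.ofRealCLM ∘ ψ) := hψc.comp_left rfl
  have c2 : ContDiff ℝ (⊤ : ℕ∞) (Complex.ofRealCLM ∘ ψ) := by fun_prop
  set Ψ : 𝓢(ℝ, ℂ) := c1.toSchwartzMap c2 with hΨ
  have e : ∀ x, Ψ x = (ψ x : ℂ) := fun x => rfl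
  -- Both transforms are tested against Ψ: `k` moves the L² transform onto Ψ by compatibility with
  -- tempered distributions, and `k2` does the same for the Fourier integral.
  have k := congrArg (fun T => T Ψ) (Lp.fourier_toTemperedDistribution_eq (h2.toLp g))
  simp only [TemperedDistribution.fourier_apply, Lp.toTemperedDistribution_apply, e] at k
  have k2 := VectorFourier.integral_fourierIntegral_smul_eq_flip (L := innerₗ ℝ)
      Real.continuous_fourierChar continuous_inner (SchwartzMap.integrable (μ := volume) Ψ) h1
  have k3 : ∫ x, (𝓕 Ψ) x • (h2.toLp g) x = ∫ x, (𝓕 Ψ) x • g x := by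
    refine integral_congr_ae ?_
    filter_upwards [h2.coeFn_toLp] with x hx
    rw [hx]
  rw [k3] at k
  rw [flip_innerₗ] at k2
  calc _ = ∫ x, (ψ x : ℂ) • (𝓕 (h2.toLp g) : Lp ℂ 2 (volume : Measure ℝ)) x := by simp
    _ = ∫ x, (𝓕 Ψ) x • g x := k.symm
    _ = ∫ x, Ψ x • 𝓕 g x := k2
    _ = _ := by simp [e]

open FourierTransform in
/-- Plancherel's theorem on `L¹ ∩ L²`. -/
theorem eLpNorm_fourier_eq {g : ℝ → ℂ} (h1 : Integrable g) (h2 : MemLp g 2) :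
    eLpNorm (𝓕 g) 2 volume = eLpNorm g 2 volume := by
  rw [← eLpNorm_congr_ae (fourier_toLp_ae_eq h1 h2), ← eLpNorm_congr_ae h2.coeFn_toLp,
    ← Lp.enorm_def, ← Lp.enorm_def, ← ofReal_norm, ← ofReal_norm, Lp.norm_fourier_eq]

/-! ### The Laplace transform on L²(ℝ₊) -/

theorem norm_exp_neg_mul (s : ℂ) (t : ℝ) : ‖Complex.exp (-s * t)‖ = Real.exp (-s.re * t) := by
  rw [Complex.norm_exp]; simp

theorem memLp_real_exp {a : ℝ} (ha : 0 < a) : MemLp (fun t : ℝ => Real.exp (-a * t)) 2 halfLine := by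
  rw [memLp_two_iff_integrable_sq (by fun_prop)]
  refine (integrableOn_exp_mul_Ioi (a := -(2 * a)) (by linarith) 0).congr
    (Eventually.of_forall fun t => ?_)
  simp only [← Real.exp_nat_mul]
  congr 1; push_cast; ring

theorem memLp_exp_neg_mul {s : ℂ} (hs : 0 < s.re) :
    MemLp (fun t : ℝ => Complex.exp (-s * t)) 2 halfLine :=
  (memLp_real_exp hs).mono (by fun_prop) (Eventually.of_forall fun t => by
    rw [norm_exp_neg_mul, Real.norm_of_nonneg (Real.exp_nonneg _)])

theorem integrable_exp_neg_mul {s : ℂ} (hs : 0 < s.re) {φ : ℝ → ℂ} (hφ : MemLp φ 2 halfLine) :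
    Integrable (fun t : ℝ => Complex.exp (-s * t) * φ t) halfLine :=
  memLp_one_iff_integrable.1 (hφ.mul (memLp_exp_neg_mul hs))

theorem laplace_congr_ae {φ ψ : ℝ → ℂ} (h : φ =ᵐ[halfLine] ψ) : laplace φ = laplace ψ := by
  funext s
  refine integral_congr_ae ?_
  filter_upwards [h] with t ht
  rw [ht]

/-- The kernel `e^{-s̄t}` representing `u ↦ 𝓛(u)(s)` as an inner product. -/
def laplaceKernel {s : ℂ} (hs : 0 < s.re) : L2 :=
  (memLp_exp_neg_mul (s := starRingEnd ℂ s) (by simpa using hs)).toLp _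

theorem laplace_eq_inner {s : ℂ} (hs : 0 < s.re) (u : L2) :
    laplace u s = inner ℂ (laplaceKernel hs) u := by
  rw [L2.inner_def]
  refine integral_congr_ae ?_
  filter_upwards [(memLp_exp_neg_mul (s := starRingEnd ℂ s) (by simpa using hs)).coeFn_toLp]
    with t ht
  rw [laplaceKernel, ht, RCLike.inner_apply, mul_comm, ← Complex.exp_conj]
  simp

/-- Differentiation under the integral sign, with a dominating function valid for Re z > Re s / 2.
-/
theorem differentiableOn_laplace {φ : ℝ → ℂ} (hφ : MemLp φ 2 halfLine) :
    DifferentiableOn ℂ (laplace φ) rightHalfPlane := by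
  intro s (hs : 0 < s.re)
  have hs2 : 0 < s.re / 2 := by linarith
  have hs4 : 0 < s.re / 4 := by linarith
  have hmeas : ∀ z : ℂ, AEStronglyMeasurable (fun t : ℝ => Complex.exp (-z * t) * φ t) halfLine :=
    fun z => (by fun_prop : AEStronglyMeasurable (fun t : ℝ => Complex.exp (-z * t))
      halfLine).mul hφ.1
  have hb : Integrable (fun t : ℝ => (4 / s.re) * (Real.exp (-(s.re / 4) * t) * ‖φ t‖)) halfLine :=
    (memLp_one_iff_integrable.1 (hφ.norm.mul (memLp_real_exp hs4))).const_mul _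
  have hU : {z : ℂ | s.re / 2 < z.re} ∈ 𝓝 s :=
    (isOpen_lt continuous_const Complex.continuous_re).mem_nhds (by simp; linarith)
  refine (hasDerivAt_integral_of_dominated_loc_of_deriv_le (μ := halfLine)
    (F := fun (z : ℂ) (t : ℝ) => Complex.exp (-z * t) * φ t)
    (F' := fun (z : ℂ) (t : ℝ) => (-(t : ℂ)) * (Complex.exp (-z * t) * φ t)) hU
    (Eventually.of_forall hmeas) (integrable_exp_neg_mul hs hφ)
    ((by fun_prop : AEStronglyMeasurable (fun t : ℝ => (-(t : ℂ))) halfLine).mul (hmeas s))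
    ?_ hb ?_).2.differentiableAt.differentiableWithinAt
  · filter_upwards [ae_restrict_mem measurableSet_Ioi] with t (ht : 0 < t) z (hz : s.re / 2 < z.re)
    rw [norm_mul, norm_mul, norm_neg, norm_exp_neg_mul, Complex.norm_real,
      Real.norm_of_nonneg ht.le, ← mul_assoc, ← mul_assoc]
    refine mul_le_mul_of_nonneg_right ?_ (norm_nonneg _)
    -- The decay exp(-(Re s / 2) t) is split in two: one half absorbs the factor t at the cost of 4
    -- / Re s, the other keeps the bound integrable against ‖φ‖.
    have e1 : Real.exp (-z.re * t) ≤ Real.exp (-(s.re / 4) * t) * Real.exp (-(s.re / 4) * t) := by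
      rw [← Real.exp_add, Real.exp_le_exp]; nlinarith
    have e2 : s.re / 4 * t * Real.exp (-(s.re / 4) * t) ≤ 1 := by
      have := Real.add_one_le_exp (s.re / 4 * t)
      rw [neg_mul, Real.exp_neg, ← div_eq_mul_inv, div_le_one (Real.exp_pos _)]
      linarith
    calc t * Real.exp (-z.re * t)
        ≤ t * (Real.exp (-(s.re / 4) * t) * Real.exp (-(s.re / 4) * t)) := by gcongr
      _ = 4 / s.re * ((s.re / 4 * t * Real.exp (-(s.re / 4) * t)) * Real.exp (-(s.re / 4) * t)) := by
        field_simp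
      _ ≤ 4 / s.re * (1 * Real.exp (-(s.re / 4) * t)) := by gcongr
      _ = _ := by rw [one_mul]
  · refine Eventually.of_forall fun t z _ => ?_
    have h1 : HasDerivAt (fun z : ℂ => -z * t) (-(t : ℂ)) z := by
      simpa using ((hasDerivAt_id z).neg.mul_const (t : ℂ))
    convert! h1.cexp.mul_const (φ t) using 1
    ring

/-! ### Hardy means, injectivity and the inverse transform -/

/-- The function `e^{-xt} φ(t)`, extended by `0` to the negative half-line. -/
def damped (x : ℝ) (φ : ℝ → ℂ) : ℝ → ℂ :=
  (Ioi (0 : ℝ)).indicator fun t : ℝ => Complex.exp (-(x : ℂ) * t) * φ t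

theorem integrable_damped {x : ℝ} (hx : 0 < x) {φ : ℝ → ℂ} (hφ : MemLp φ 2 halfLine) :
    Integrable (damped x φ) :=
  (integrable_indicator_iff measurableSet_Ioi).2 (integrable_exp_neg_mul (by simpa using hx) hφ)

theorem norm_exp_mul_le {x : ℝ} (hx : 0 < x) (φ : ℝ → ℂ) :
    ∀ᵐ t : ℝ ∂halfLine, ‖Complex.exp (-(x : ℂ) * t) * φ t‖ ≤ ‖φ t‖ := by
  filter_upwards [ae_restrict_mem measurableSet_Ioi] with t (ht : 0 < t)
  rw [norm_mul, norm_exp_neg_mul]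
  refine mul_le_of_le_one_left (norm_nonneg _) (Real.exp_le_one_iff.2 ?_)
  simp only [Complex.ofReal_re]
  nlinarith

theorem memLp_damped {x : ℝ} (hx : 0 < x) {φ : ℝ → ℂ} (hφ : MemLp φ 2 halfLine) :
    MemLp (damped x φ) 2 :=
  (memLp_indicator_iff_restrict measurableSet_Ioi).2
    (hφ.mono ((integrable_exp_neg_mul (by simpa using hx) hφ).1) (norm_exp_mul_le hx φ))

theorem eLpNorm_damped_le {x : ℝ} (hx : 0 < x) (φ : ℝ → ℂ) :
    eLpNorm (damped x φ) 2 volume ≤ eLpNorm φ 2 halfLine := by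
  rw [damped, eLpNorm_indicator_eq_eLpNorm_restrict measurableSet_Ioi]
  exact eLpNorm_mono_ae (norm_exp_mul_le hx φ)

open FourierTransform in
theorem laplace_eq_fourier_damped (φ : ℝ → ℂ) (x y : ℝ) :
    laplace φ (x + y * Complex.I) = 𝓕 (damped x φ) (y * (2 * Real.pi)⁻¹) := by
  rw [Real.fourier_eq', laplace, ← integral_indicator measurableSet_Ioi]
  congr 1
  funext t
  by_cases ht : t ∈ Ioi (0 : ℝ)
  · rw [damped, indicator_of_mem ht, indicator_of_mem ht, smul_eq_mul, ← mul_assoc,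
      ← Complex.exp_add]
    congr 2
    have : (Real.pi : ℂ) ≠ 0 := by exact_mod_cast Real.pi_ne_zero
    simp
    field_simp
  · rw [damped, indicator_of_notMem ht, indicator_of_notMem ht, smul_zero]

/-- Plancherel on the line Re s = x; the substitution y ↦ y / 2π cancels the factor 1/2π in the
Hardy mean. -/
theorem hardyMean_laplace {φ : ℝ → ℂ} (hφ : MemLp φ 2 halfLine) {x : ℝ} (hx : 0 < x) :
    hardyMean 2 (laplace φ) x = eLpNorm (damped x φ) 2 volume := by
  open FourierTransform in
  rw [← eLpNorm_fourier_eq (integrable_damped hx hφ) (memLp_damped hx hφ), hardyMean,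
    eLpNorm_eq_lintegral_rpow_enorm_toReal (by norm_num) (by norm_num)]
  have hpi : (0 : ℝ) < 2 * Real.pi := by positivity
  simp only [laplace_eq_fourier_damped, ENNReal.toReal_ofNat]
  congr 1
  open FourierTransform in
  have key := (Homeomorph.mulRight₀ ((2 * Real.pi)⁻¹ : ℝ) (by positivity)).measurableEmbedding.lintegral_map
    (μ := volume) (fun y => ‖𝓕 (damped x φ) y‖ₑ ^ (2 : ℝ))
  simp only [Homeomorph.coe_mulRight₀] at key
  rw [Real.map_volume_mul_right (by positivity), inv_inv, abs_of_pos hpi,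
    lintegral_smul_measure] at key
  rw [← key, smul_eq_mul, ← mul_assoc, ENNReal.inv_mul_cancel, one_mul]
  · simpa using Real.pi_pos
  · exact ENNReal.ofReal_ne_top

/-- The easy half of the Paley-Wiener theorem: Laplace transforms of `L²` functions are in `H²`. -/
theorem isHardy_laplace {φ : ℝ → ℂ} (hφ : MemLp φ 2 halfLine) : IsHardy 2 (laplace φ) := by
  refine ⟨differentiableOn_laplace hφ, (eLpNorm φ 2 halfLine).toNNReal, fun x hx => ?_⟩
  rw [hardyMean_laplace hφ hx, ENNReal.coe_toNNReal hφ.eLpNorm_ne_top]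
  exact eLpNorm_damped_le hx φ

theorem IsHardy.congr {q : ℝ} {Φ Ψ : ℂ → ℂ} (h : IsHardy q Φ) (e : EqOn Ψ Φ rightHalfPlane) :
    IsHardy q Ψ := by
  obtain ⟨h1, M, hM⟩ := h
  refine ⟨h1.congr e, M, fun x hx => ?_⟩
  have : hardyMean q Ψ x = hardyMean q Φ x := by
    simp only [hardyMean]
    congr 3 with y
    rw [e (by simpa [rightHalfPlane] using hx)]
  rw [this]
  exact hM x hx

/-- The Laplace transform is injective on `L²(ℝ₊)`. -/
theorem laplace_injective {u v : L2} (h : EqOn (laplace u) (laplace v) rightHalfPlane) : u = v := by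
  rw [← sub_eq_zero]
  set w : L2 := u - v with hw
  have h0 : ∀ s ∈ rightHalfPlane, laplace w s = 0 := by
    intro s hs
    have := h hs
    rw [laplace_eq_inner hs, laplace_eq_inner hs] at this
    rw [laplace_eq_inner hs, hw, inner_sub_right, this, sub_self]
  -- A single vertical line suffices: vanishing on Re s = 1 forces e^{-t} w(t) = 0 almost
  -- everywhere.
  have hm := hardyMean_laplace (Lp.memLp w) one_pos
  have hz : hardyMean 2 (laplace w) 1 = 0 := by
    have : ∀ y : ℝ, laplace w ((1 : ℝ) + y * Complex.I) = 0 := fun y =>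
      h0 _ (by simp [rightHalfPlane])
    simp only [hardyMean, this]
    simp
  rw [hz, eq_comm, eLpNorm_eq_zero_iff (memLp_damped one_pos (Lp.memLp w)).1 (by norm_num)] at hm
  refine Lp.ext ?_
  have z : ((0 : L2) : ℝ → ℂ) =ᵐ[halfLine] 0 := Lp.coeFn_zero ℂ 2 halfLine
  filter_upwards [z, ae_restrict_of_ae hm, ae_restrict_mem measurableSet_Ioi] with t h1 h2 h3
  rw [h1]
  simpa [damped, indicator_of_mem h3] using h2

theorem inverseLaplace_eq {G : ℂ → ℂ} {u : L2} (h : EqOn (laplace u) G rightHalfPlane) :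
    inverseLaplace G = u := by
  have hex : ∃ u : L2, EqOn (laplace u) G rightHalfPlane := ⟨u, h⟩
  rw [inverseLaplace, dif_pos hex]
  exact laplace_injective (hex.choose_spec.trans h.symm)

/-! ### Weak and classical derivatives -/

theorem integrableOn_smul_of_continuousOn {χ : ℝ → ℝ} (hc : Continuous χ) (hs : HasCompactSupport χ)
    {g : ℝ → ℂ} (hg : ContinuousOn g (Ici 0)) : IntegrableOn (fun t => χ t • g t) (Ioi 0) := by
  have hK : IsCompact (tsupport χ ∩ Ici 0) := hs.isCompact.inter_right isClosed_Ici
  have h1 : IntegrableOn (fun t => χ t • g t) (tsupport χ ∩ Ici 0) :=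
    (hc.continuousOn.smul (hg.mono inter_subset_right)).integrableOn_compact hK
  refine h1.of_forall_sdiff_eq_zero measurableSet_Ioi fun t ht => ?_
  have : t ∉ tsupport χ := fun h => ht.2 ⟨h, mem_Ici.2 (mem_Ioi.1 ht.1).le⟩
  rw [image_eq_zero_of_notMem_tsupport this, zero_smul]

/-- A classical derivative is a weak derivative. -/
theorem isWeakDeriv_of_hasDerivAt {g g' : ℝ → ℂ} (hg : ContinuousOn g (Ici 0))
    (hg' : ContinuousOn g' (Ici 0)) (hd : ∀ t ∈ Ioi (0 : ℝ), HasDerivAt g (g' t) t) :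
    IsWeakDeriv g g' := by
  intro ψ h1 h2 h3
  have i1 := integrableOn_smul_of_continuousOn (h1.continuous_deriv (by norm_num)) h2.deriv hg
  have i2 := integrableOn_smul_of_continuousOn h1.continuous h2 hg'
  -- The support of ψ avoids 0, so integration by parts leaves no boundary term there.
  have h0 : ψ 0 = 0 := image_eq_zero_of_notMem_tsupport fun h => lt_irrefl (0 : ℝ) (h3 h)
  have key := integral_Ioi_of_hasDerivAt_of_tendsto (a := 0) (f := fun t => ψ t • g t)
    (f' := fun t => ψ t • g' t + deriv ψ t • g t) (m := 0)
    ((h1.continuous.continuousAt.continuousWithinAt).smul (hg 0 (mem_Ici.2 le_rfl)))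
    (fun t ht => ((h1.differentiable (by norm_num) t).hasDerivAt).smul (hd t ht))
    (i2.add i1)
    (tendsto_const_nhds.congr' ?_)
  · rw [integral_add i2 i1] at key
    simp only [h0, zero_smul, sub_zero] at key
    exact eq_neg_of_add_eq_zero_right key
  · obtain ⟨b, hb⟩ := h2.isCompact.bddAbove
    filter_upwards [eventually_gt_atTop b] with t ht
    rw [image_eq_zero_of_notMem_tsupport fun h => absurd (hb h) (not_le.2 ht), zero_smul]

/-- Uniqueness of weak derivatives. -/
theorem IsWeakDeriv.ae_eq {u v v' : ℝ → ℂ} (h : IsWeakDeriv u v) (h' : IsWeakDeriv u v')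
    (hv : LocallyIntegrableOn v (Ioi 0)) (hv' : LocallyIntegrableOn v' (Ioi 0)) :
    v =ᵐ[halfLine] v' := by
  have key := isOpen_Ioi.ae_eq_zero_of_integral_contDiff_smul_eq_zero (hv.sub hv')
    (fun ψ h1 h2 h3 => by
      have hsub : ∀ w : ℝ → ℂ, LocallyIntegrableOn w (Ioi 0) →
          Integrable (fun t => ψ t • w t) halfLine := by
        intro w hw
        have h4 : IntegrableOn (fun t => ψ t • w t) (tsupport ψ) :=
          (hw.integrableOn_compact_subset h3 h2.isCompact).continuousOn_smul
            h1.continuous.continuousOn h2.isCompact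
        refine (h4.of_forall_sdiff_eq_zero measurableSet_Ioi fun t ht => ?_)
        rw [image_eq_zero_of_notMem_tsupport ht.2, zero_smul]
      have e : ∫ t, ψ t • (v - v') t = ∫ t in Ioi 0, ψ t • (v - v') t := by
        rw [setIntegral_eq_integral_of_forall_compl_eq_zero]
        intro t ht
        rw [image_eq_zero_of_notMem_tsupport (fun hh => ht (h3 hh)), zero_smul]
      rw [e]
      simp only [Pi.sub_apply, smul_sub]
      rw [integral_sub (hsub v hv) (hsub v' hv'), sub_eq_zero]
      exact neg_inj.1 ((h ψ h1 h2 h3).symm.trans (h' ψ h1 h2 h3)))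
  filter_upwards [(ae_restrict_iff' measurableSet_Ioi).2 key] with t ht
  exact sub_eq_zero.1 ht

theorem IsWeakDeriv.congr_left {u u' v : ℝ → ℂ} (h : IsWeakDeriv u v) (e : u =ᵐ[halfLine] u') :
    IsWeakDeriv u' v := by
  intro ψ h1 h2 h3
  rw [← h ψ h1 h2 h3]
  refine integral_congr_ae ?_
  filter_upwards [e] with t ht
  rw [ht]

theorem MemLp.locallyIntegrableOn_Ioi {v : ℝ → ℂ} (hv : MemLp v 2 halfLine) :
    LocallyIntegrableOn v (Ioi 0) := by
  rw [locallyIntegrableOn_iff isOpen_Ioi.isLocallyClosed]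
  intro k hk hkc
  have h1 : MemLp v 2 (volume.restrict k) := hv.mono_measure (Measure.restrict_mono hk le_rfl)
  have : IsFiniteMeasure (volume.restrict k) := ⟨by simpa using hkc.measure_lt_top⟩
  exact h1.integrable (by norm_num)

section derivHalf

variable {φ : ℝ → ℂ} (hφ : ContDiffOn ℝ (⊤ : ℕ∞) φ (Ici 0))
include hφ

theorem continuousOn_derivHalf (n : ℕ) : ContinuousOn (derivHalf n φ) (Ici 0) :=
  hφ.continuousOn_iteratedDerivWithin (by exact_mod_cast le_top) (uniqueDiffOn_Ici 0)

theorem hasDerivAt_derivHalf (n : ℕ) {t : ℝ} (ht : t ∈ Ioi (0 : ℝ)) :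
    HasDerivAt (derivHalf n φ) (derivHalf (n + 1) φ t) t := by
  have h := hφ.differentiableOn_iteratedDerivWithin (m := n)
    (by exact_mod_cast WithTop.coe_lt_top _) (uniqueDiffOn_Ici 0) t (mem_Ici.2 (mem_Ioi.1 ht).le)
  have h2 := h.hasDerivWithinAt.hasDerivAt (Ici_mem_nhds ht)
  rwa [← iteratedDerivWithin_succ] at h2

/-- The weak derivatives of a smooth function on `[0, ∞)` are its classical derivatives. -/
theorem IsOrbit.ae_eq_derivHalf {v : L2} (hv : v =ᵐ[halfLine] φ) {w : ℕ → L2}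
    (hw : IsOrbit ddt v w) (n : ℕ) : w n =ᵐ[halfLine] derivHalf n φ := by
  induction n with
  | zero =>
    rw [hw.1]
    simpa [derivHalf, iteratedDerivWithin_zero] using hv
  | succ n ih =>
    have h1 : IsWeakDeriv (w n) (w (n + 1)) := by
      have := hw.2 n
      rwa [ddt_graph] at this
    exact (h1.congr_left ih).ae_eq
      (isWeakDeriv_of_hasDerivAt (continuousOn_derivHalf hφ n) (continuousOn_derivHalf hφ (n + 1))
        fun t ht => hasDerivAt_derivHalf hφ n ht)
      (MemLp.locallyIntegrableOn_Ioi (Lp.memLp _))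
      (((continuousOn_derivHalf hφ (n + 1)).mono Ioi_subset_Ici_self).locallyIntegrableOn
        measurableSet_Ioi)

end derivHalf

/-! ### Laplace transforms of derivatives -/

/-- The Laplace transform of a derivative. -/
theorem laplace_of_hasDerivAt {g g' : ℝ → ℂ} (hg : ContinuousOn g (Ici 0))
    (hd : ∀ t ∈ Ioi (0 : ℝ), HasDerivAt g (g' t) t) (h2 : MemLp g 2 halfLine)
    (h2' : MemLp g' 2 halfLine) {s : ℂ} (hs : 0 < s.re) :
    laplace g' s = s * laplace g s - g 0 := by
  have i1 := integrable_exp_neg_mul hs h2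
  have i2 := integrable_exp_neg_mul hs h2'
  have hexp : ∀ t : ℝ, HasDerivAt (fun t : ℝ => Complex.exp (-s * t))
      (-s * Complex.exp (-s * t)) t := by
    intro t
    have := ((Complex.ofRealCLM.hasDerivAt (x := t)).const_mul (-s)).cexp
    convert! this using 1
    simp [mul_comm]
  have hder : ∀ t ∈ Ioi (0 : ℝ), HasDerivAt (fun t : ℝ => Complex.exp (-s * t) * g t)
      (-s * (Complex.exp (-s * t) * g t) + Complex.exp (-s * t) * g' t) t := by
    intro t ht
    convert! (hexp t).mul (hd t ht) using 1
    ring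
  have i3 : IntegrableOn (fun t : ℝ => -s * (Complex.exp (-s * t) * g t)
      + Complex.exp (-s * t) * g' t) (Ioi 0) := (i1.const_mul _).add i2
  -- The boundary term at infinity vanishes because e^{-st} g(t) and its derivative are both
  -- integrable.
  have key := integral_Ioi_of_hasDerivAt_of_tendsto (a := 0)
    (f := fun t : ℝ => Complex.exp (-s * t) * g t) (((hexp 0).continuousAt.continuousWithinAt).mul (hg 0 (mem_Ici.2 le_rfl))) hder i3
    (tendsto_zero_of_hasDerivAt_of_integrableOn_Ioi hder i3 i1)
  rw [integral_add (i1.const_mul _) i2, integral_const_mul] at key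
  simp only [Complex.ofReal_zero, mul_zero, Complex.exp_zero, one_mul] at key
  rw [laplace, laplace]
  linear_combination key

theorem laplace_derivHalf {φ : ℝ → ℂ} (hφ : ContDiffOn ℝ (⊤ : ℕ∞) φ (Ici 0))
    (hmem : ∀ n, MemLp (derivHalf n φ) 2 halfLine) {s : ℂ} (hs : 0 < s.re) (n : ℕ) :
    laplace (derivHalf n φ) s = s ^ n * laplace φ s
      - ∑ j ∈ Finset.Icc 1 n, derivHalf (j - 1) φ 0 * s ^ (n - j) := by
  induction n with
  | zero =>
    have : derivHalf 0 φ = φ := iteratedDerivWithin_zero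
    simp [this]
  | succ n ih =>
    rw [laplace_of_hasDerivAt (continuousOn_derivHalf hφ n)
      (fun t ht => hasDerivAt_derivHalf hφ n ht) (hmem n) (hmem (n + 1)) hs, ih,
      Finset.sum_Icc_succ_top (by omega)]
    have : ∑ j ∈ Finset.Icc 1 n, derivHalf (j - 1) φ 0 * s ^ (n + 1 - j)
        = s * ∑ j ∈ Finset.Icc 1 n, derivHalf (j - 1) φ 0 * s ^ (n - j) := by
      rw [Finset.mul_sum]
      refine Finset.sum_congr rfl fun j hj => ?_
      rw [Nat.succ_sub (Finset.mem_Icc.1 hj).2, pow_succ]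
      ring
    rw [this]
    simp
    ring

/-! ### The initial-data series and passage to the limit -/

theorem hasSum_taylorCoeff {f : ℂ → ℂ} (hf : Differentiable ℂ f) (s : ℂ) :
    HasSum (fun n => taylorCoeff f n * s ^ n) (f s) := by
  refine (Complex.hasSum_taylorSeries_of_entire hf 0 s).congr_fun fun n => ?_
  simp [taylorCoeff]
  ring

/-- There are n summands, each at most ‖f⁽ⁿ⁾(0)/n!‖ C ρⁿ; the 2 in 2ρ comes from n ≤ 2ⁿ. -/
theorem norm_initialTerm_le (f : ℂ → ℂ) {d : ℕ → ℂ} {C ρ : ℝ} (hd : ∀ j, ‖d j‖ ≤ C)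
    (hρ : 1 ≤ ρ) {s : ℂ} (hs : ‖s‖ ≤ ρ) (n : ℕ) :
    ‖initialTerm f d s n‖ ≤ C * (‖taylorCoeff f n‖ * (2 * ρ) ^ n) := by
  have hC : 0 ≤ C := (norm_nonneg _).trans (hd 0)
  have h1 : ∀ j ∈ Finset.Icc 1 n,
      ‖taylorCoeff f n * d (j - 1) * s ^ (n - j)‖ ≤ ‖taylorCoeff f n‖ * C * ρ ^ n := by
    intro j _
    rw [norm_mul, norm_mul, norm_pow]
    gcongr
    · exact hd _
    · exact (pow_le_pow_left₀ (norm_nonneg _) hs _).trans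
        (pow_le_pow_right₀ hρ (Nat.sub_le n j))
  refine (norm_sum_le_of_le _ h1).trans ?_
  rw [Finset.sum_const, Nat.card_Icc, nsmul_eq_mul, Nat.add_sub_cancel, mul_pow]
  have h2 : (n : ℝ) ≤ 2 ^ n := by exact_mod_cast n.lt_two_pow_self.le
  calc (n : ℝ) * (‖taylorCoeff f n‖ * C * ρ ^ n)
      ≤ 2 ^ n * (‖taylorCoeff f n‖ * C * ρ ^ n) := by gcongr
    _ = _ := by ring

theorem summable_norm_taylorCoeff {f : ℂ → ℂ} (hf : Differentiable ℂ f) {ρ : ℝ} (hρ : 0 ≤ ρ) :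
    Summable fun n => ‖taylorCoeff f n‖ * ρ ^ n := by
  refine (hasSum_taylorCoeff hf (ρ : ℂ)).summable.norm.congr fun n => ?_
  rw [norm_mul, norm_pow, Complex.norm_real, Real.norm_of_nonneg hρ]

theorem summable_initialTerm {f : ℂ → ℂ} (hf : Differentiable ℂ f) {d : ℕ → ℂ} {C : ℝ}
    (hd : ∀ j, ‖d j‖ ≤ C) (s : ℂ) : Summable (initialTerm f d s) :=
  .of_norm_bounded ((summable_norm_taylorCoeff hf (ρ := 2 * max 1 ‖s‖) (by positivity)).mul_left C)
    (norm_initialTerm_le f hd (le_max_left _ _) (le_max_right _ _))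

theorem differentiable_initialSeries {f : ℂ → ℂ} (hf : Differentiable ℂ f) {d : ℕ → ℂ} {C : ℝ}
    (hd : ∀ j, ‖d j‖ ≤ C) : Differentiable ℂ (initialSeries f d) := by
  intro s
  have hρ : (1 : ℝ) ≤ ‖s‖ + 1 := by linarith [norm_nonneg s]
  -- Weierstrass M-test on a ball that contains s and whose radius is at least 1, as the term bound
  -- requires.
  have h := Complex.differentiableOn_tsum_of_summable_norm
    (F := fun n z => initialTerm f d z n) (U := Metric.ball 0 (‖s‖ + 1))
    ((summable_norm_taylorCoeff hf (ρ := 2 * (‖s‖ + 1)) (by positivity)).mul_left C)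
    (fun n => by unfold initialTerm; fun_prop) Metric.isOpen_ball
    (fun n z hz => norm_initialTerm_le f hd hρ (mem_ball_zero_iff.1 hz).le n)
  exact h.differentiableAt (Metric.isOpen_ball.mem_nhds (by simp))

theorem laplace_of_tendsto {f : ℂ → ℂ} (hf : Differentiable ℂ f) {φ : ℝ → ℂ}
    (hφ : ContDiffOn ℝ (⊤ : ℕ∞) φ (Ici 0)) {C : ℝ} (hd : ∀ j, ‖derivHalf j φ 0‖ ≤ C)
    (hmem : ∀ n, MemLp (derivHalf n φ) 2 halfLine) {u : L2}
    (hu : Tendsto (fun N => ∑ n ∈ Finset.range N, taylorCoeff f n • (hmem n).toLp (derivHalf n φ))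
      atTop (𝓝 u)) :
    EqOn (laplace u)
      (fun s => f s * laplace φ s - initialSeries f (fun j => derivHalf j φ 0) s)
      rightHalfPlane := by
  intro s hs
  have h1 : Tendsto (fun N => ∑ n ∈ Finset.range N, (taylorCoeff f n * s ^ n * laplace φ s
      - initialTerm f (fun j => derivHalf j φ 0) s n)) atTop
      (𝓝 (f s * laplace φ s - initialSeries f (fun j => derivHalf j φ 0) s)) :=
    (((hasSum_taylorCoeff hf s).mul_right _).sub
      (summable_initialTerm hf hd s).hasSum).tendsto_sum_nat
  rw [laplace_eq_inner hs]
  -- Continuity of the inner product gives one limit of the transformed partial sums, the scalar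
  -- series the other.
  refine tendsto_nhds_unique (tendsto_const_nhds.inner hu) (h1.congr fun N => ?_)
  rw [inner_sum]
  refine Finset.sum_congr rfl fun n _ => ?_
  rw [inner_smul_right, ← laplace_eq_inner hs, laplace_congr_ae (hmem n).coeFn_toLp,
    laplace_derivHalf hφ hmem hs, initialTerm, mul_sub, Finset.mul_sum]
  simp only [mul_assoc]

end InfiniteOrder

end

theorem mainTheorem9 (f : ℂ → ℂ) (hf : Differentiable ℂ f)
    (φ : ℝ → ℂ) (hφ : ContDiffOn ℝ (⊤ : ℕ∞) φ (Set.Ici 0))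
    (hφ2 : MeasureTheory.MemLp φ 2 InfiniteOrder.halfLine)
    (hφf : InfiniteOrder.IsAnalyticVector f InfiniteOrder.ddt (hφ2.toLp φ))
    (C R : ℝ) (hR0 : 0 < R) (hR1 : R < 1)
    (hd : ∀ j : ℕ, ‖InfiniteOrder.derivHalf j φ 0‖ ≤ C * R ^ j)
    (r : ℂ → ℂ)
    (hr : r = InfiniteOrder.initialSeries f (fun j => InfiniteOrder.derivHalf j φ 0)) :
    -- the series `r` converges everywhere and is an entire function
    (∀ s : ℂ, Summable (InfiniteOrder.initialTerm f (fun j => InfiniteOrder.derivHalf j φ 0) s)) ∧ Differentiable ℂ r ∧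
    -- `(φ, r)` is in the domain of `f(∂_t)`
    ∃ hD : (hφ2.toLp φ, r) ∈ InfiniteOrder.symbolDomain f,
      -- the Laplace transform of `f(∂_t) φ` is `f 𝓛(φ) - r`
      Set.EqOn (InfiniteOrder.laplace (InfiniteOrder.symbolOp f ⟨(hφ2.toLp φ, r), hD⟩))
        (fun s => f s * InfiniteOrder.laplace φ s - r s) InfiniteOrder.rightHalfPlane ∧
      -- `f(∂_t) φ = ∑ f⁽ⁿ⁾(0)/n! ∂_tⁿ φ` in `L²(ℝ₊)`, where `∂_tⁿ φ = φ⁽ⁿ⁾`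
      ∃ hmem : ∀ n : ℕ, MeasureTheory.MemLp (InfiniteOrder.derivHalf n φ) 2 InfiniteOrder.halfLine,
        InfiniteOrder.IsOrbit InfiniteOrder.ddt (hφ2.toLp φ)
          (fun n => (hmem n).toLp (InfiniteOrder.derivHalf n φ)) ∧
        Filter.Tendsto
          (fun N : ℕ => ∑ n ∈ Finset.range N, InfiniteOrder.taylorCoeff f n •
            (hmem n).toLp (InfiniteOrder.derivHalf n φ))
          Filter.atTop
          (nhds (InfiniteOrder.symbolOp f ⟨(hφ2.toLp φ, r), hD⟩)) := by
  open InfiniteOrder in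
  obtain ⟨w, hw, L, hL⟩ := hφf
  have hw' := IsOrbit.ae_eq_derivHalf hφ hφ2.coeFn_toLp hw
  have hC : 0 ≤ C := by simpa using (norm_nonneg _).trans (hd 0)
  have hd' : ∀ j, ‖derivHalf j φ 0‖ ≤ C := fun j =>
    (hd j).trans (mul_le_of_le_one_right hC (pow_le_one₀ hR0.le hR1.le))
  -- Square integrability of φ⁽ⁿ⁾ is inherited from the orbit element `w n`, which agrees with it
  -- almost everywhere.
  have hmem : ∀ n, MemLp (derivHalf n φ) 2 halfLine := fun n => (Lp.memLp (w n)).ae_eq (hw' n)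
  have hwe : (fun n => (hmem n).toLp (derivHalf n φ)) = w := funext fun n =>
    Lp.ext ((hmem n).coeFn_toLp.trans (hw' n).symm)
  have hL' : Tendsto (fun N : ℕ => ∑ n ∈ Finset.range N,
      taylorCoeff f n • (hmem n).toLp (derivHalf n φ)) atTop (𝓝 L) := by
    simpa only [← hwe] using hL
  have hlap := laplace_of_tendsto hf hφ hd' hmem hL'
  rw [← hr] at hlap
  have hcongr : laplace (hφ2.toLp φ) = laplace φ := laplace_congr_ae hφ2.coeFn_toLp
  have hhat : EqOn (laplace L) (hat f (hφ2.toLp φ) r) rightHalfPlane := by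
    intro s hs
    rw [hat, hcongr]
    exact hlap hs
  have hrd : Differentiable ℂ r := hr ▸ differentiable_initialSeries hf hd'
  have hD : (hφ2.toLp φ, r) ∈ symbolDomain f :=
    ⟨⟨univ, isOpen_univ, isConnected_univ, hrd.differentiableOn⟩,
      (isHardy_laplace (Lp.memLp L)).congr hhat.symm⟩
  have hop : symbolOp f ⟨(hφ2.toLp φ, r), hD⟩ = L := inverseLaplace_eq hhat
  refine ⟨summable_initialTerm hf hd', hrd, hD, ?_, hmem, ?_, ?_⟩
  · rw [hop]
    exact hlap
  · rw [hwe]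
    exact hw
  · rw [hop]
    exact hL'
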